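/- All manifolds, differential forms and vector fields are smooth, and manifolds have no boundary. Let $M$ be a manifold of even dimension $2n$ and let $k,\ell\ge 0$ be integers. A pair $(\alpha,\beta)$ of $1$-forms on $M$ is a contact pair of type $(k,\ell)$ if $2k+2\ell+2=2n$, the form $\alpha\wedge(d\alpha)^k\wedge\beta\wedge(d\beta)^\ell$ is a volume form (that is, it vanishes nowhere), $(d\alpha)^{k+1}=0$ and $(d\beta)^{\ell+1}=0$. Its pair of Reeb vector fields is the pair $(E_\alpha,E_\beta)$ of vector fields determined by $$\alpha(E_\alpha)=\beta(E_\beta)=1,\quad \alpha(E_\beta)=\beta(E_\alpha)=0,\quad i_{E_\alpha}d\alpha=i_{E_\beta}d\alpha=i_{E_\alpha}d\beta=i_{E_\beta}d\beta=0.$$ Let $\alpha_0,\beta_0$ be closed $1$-forms on $M$ that are linearly independent at every point, let $\alpha,\beta$ be $1$-forms on $M$, and put $\alpha_t=\alpha_0+t\alpha$, $\beta_t=\beta_0+t\beta$ for $t\in\mathbb R$. 1. Suppose $(\alpha,\beta)$ is a contact pair of type $(k,\ell)$ whose Reeb vector fields satisfy $$\alpha_0(E_\alpha)=\alpha_0(E_\beta)=\beta_0(E_\alpha)=\beta_0(E_\beta)=0.\qquad(*)$$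 Then for every $t>0$ the pair $(\alpha_t,\beta_t)$ is a contact pair of type $(k,\ell)$, and its pair of Reeb vector fields is $(\tfrac1t E_\alpha,\tfrac1t E_\beta)$. 2. Suppose $M$ is closed (compact) and oriented, and $X,Y$ are vector fields on $M$ such that for every $t>0$ the pair $(\alpha_t,\beta_t)$ is a contact pair of type $(k,\ell)$ with pair of Reeb vector fields $(\tfrac1t X,\tfrac1t Y)$. Then $(\alpha,\beta)$ is a contact pair of type $(k,\ell)$, its pair of Reeb vector fields is $(E_\alpha,E_\beta)=(X,Y)$, and $(*)$ holds. 3. Consequently, if $M$ is closed and oriented, the following are equivalent: (i) there are vector fields $X,Y$ on $M$ such that for every $t>0$ the pair $(\alpha_t,\beta_t)$ is a contact pair of type $(k,\ell)$ with pair of Reeb vector fields $(\tfrac1t X,\tfrac1t Y)$; (ii) $(\alpha,\beta)$ is a contact pair of type $(k,\ell)$ whose Reeb vector fields satisfy $(*)$. -/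

import Mathlib

open scoped Manifold ContDiff

namespace ContactPairs

noncomputable section

/-- The wedge product of two alternating forms on a real vector space. The map `domCoprod` sums
over `(p, q)`-shuffles, so that `(a ∧ b)(v, w) = a(v) b(w) - a(w) b(v)` for covectors `a`, `b`. -/
def wedge {V : Type*} [AddCommGroup V] [Module ℝ V] {p q : ℕ}
    (a : V [⋀^Fin p]→ₗ[ℝ] ℝ) (b : V [⋀^Fin q]→ₗ[ℝ] ℝ) : V [⋀^Fin (p + q)]→ₗ[ℝ] ℝ :=
  ((LinearMap.mul' ℝ ℝ).compAlternatingMap (a.domCoprod b)).domDomCongr finSumFinEquiv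

/-- The `k`-fold wedge power of a form of degree `2`; the zeroth power is the constant `1`. -/
def wedgePow {V : Type*} [AddCommGroup V] [Module ℝ V] (b : V [⋀^Fin 2]→ₗ[ℝ] ℝ) :
    (k : ℕ) → V [⋀^Fin (2 * k)]→ₗ[ℝ] ℝ
  | 0 => AlternatingMap.constOfIsEmpty ℝ V (Fin 0) 1
  | k + 1 => wedge (wedgePow b k) b

/-- Fields of alternating `p`-forms on the tangent spaces of a `d`-dimensional manifold `M`
(no regularity imposed; see `IsSmooth`). -/
abbrev Form (d : ℕ) (M : Type*) [TopologicalSpace M] [ChartedSpace (EuclideanSpace ℝ (Fin d)) M]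
    (p : ℕ) : Type _ :=
  ∀ x : M, TangentSpace (𝓡 d) x [⋀^Fin p]→L[ℝ] ℝ

/-- Vector fields on a `d`-dimensional manifold `M` (no regularity imposed). -/
abbrev VField (d : ℕ) (M : Type*) [TopologicalSpace M]
    [ChartedSpace (EuclideanSpace ℝ (Fin d)) M] : Type _ :=
  ∀ x : M, TangentSpace (𝓡 d) x

section Manifold

variable {d : ℕ} {M : Type*} [TopologicalSpace M] [ChartedSpace (EuclideanSpace ℝ (Fin d)) M]

/-- The expression of a form in the chart around `x₀`: its pullback under the inverse chart.
Only its values on the (open) target of the chart are meaningful. -/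
def Form.inChart {p : ℕ} (η : Form d M p) (x₀ : M) (y : EuclideanSpace ℝ (Fin d)) :
    EuclideanSpace ℝ (Fin d) [⋀^Fin p]→L[ℝ] ℝ :=
  (η ((extChartAt (𝓡 d) x₀).symm y)).compContinuousLinearMap
    (mfderiv 𝓘(ℝ, EuclideanSpace ℝ (Fin d)) (𝓡 d) (extChartAt (𝓡 d) x₀).symm y)

/-- A form is smooth if its expressions in the charts of the atlas are smooth. -/
def Form.IsSmooth {p : ℕ} (η : Form d M p) : Prop :=
  ∀ x₀ : M, ContDiffOn ℝ ∞ (η.inChart x₀) (extChartAt (𝓡 d) x₀).target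

/-- The exterior derivative: at `x`, the pullback under the chart around `x` of the exterior
derivative of the expression of the form in that chart. -/
def Form.extD {p : ℕ} (η : Form d M p) : Form d M (p + 1) := fun x =>
  (extDeriv (η.inChart x) (extChartAt (𝓡 d) x x)).compContinuousLinearMap
    (mfderiv (𝓡 d) 𝓘(ℝ, EuclideanSpace ℝ (Fin d)) (extChartAt (𝓡 d) x) x)

/-- A vector field is smooth if it is a smooth section of the tangent bundle. -/
def VField.IsSmooth [IsManifold (𝓡 d) ∞ M] (X : VField d M) : Prop :=
  ContMDiff (𝓡 d) (𝓡 d).tangent ∞ (fun x => (⟨x, X x⟩ : TangentBundle (𝓡 d) M))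

/-- The form `α ∧ (dα)^k ∧ β ∧ (dβ)^ℓ` at the point `x`. -/
def contactForm (k l : ℕ) (α β : Form d M 1) (x : M) :
    TangentSpace (𝓡 d) x [⋀^Fin (1 + 2 * k + 1 + 2 * l)]→ₗ[ℝ] ℝ :=
  wedge (wedge (wedge (α x).toAlternatingMap (wedgePow (α.extD x).toAlternatingMap k))
    (β x).toAlternatingMap) (wedgePow (β.extD x).toAlternatingMap l)

/-- `(α, β)` is a contact pair of type `(k, ℓ)`: `α` and `β` are smooth `1`-forms,
`α ∧ (dα)^k ∧ β ∧ (dβ)^ℓ` is a volume form (it has top degree and vanishes nowhere),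
`(dα)^(k+1) = 0` and `(dβ)^(ℓ+1) = 0`. -/
structure IsContactPair (k l : ℕ) (α β : Form d M 1) : Prop where
  smooth_left : α.IsSmooth
  smooth_right : β.IsSmooth
  top_degree : d = 2 * k + 2 * l + 2
  volume : ∀ x, contactForm k l α β x ≠ 0
  pow_left : ∀ x, wedgePow (α.extD x).toAlternatingMap (k + 1) = 0
  pow_right : ∀ x, wedgePow (β.extD x).toAlternatingMap (l + 1) = 0

/-- The function `α(X)`, for a `1`-form `α` and a vector field `X`. -/
def Form.eval (α : Form d M 1) (X : VField d M) (x : M) : ℝ := α x ![X x]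

/-- The contraction `i_X η` of a `2`-form vanishes identically. -/
def ContractionVanishes (X : VField d M) (η : Form d M 2) : Prop :=
  ∀ (x : M) (v : TangentSpace (𝓡 d) x), η x ![X x, v] = 0

/-- `(X, Y)` is a pair of Reeb vector fields for `(α, β)`. For a contact pair the relations
below determine `(X, Y)`. -/
structure IsReebPair [IsManifold (𝓡 d) ∞ M] (α β : Form d M 1) (X Y : VField d M) : Prop where
  smooth_left : X.IsSmooth
  smooth_right : Y.IsSmooth
  left_left : ∀ x, α.eval X x = 1
  right_right : ∀ x, β.eval Y x = 1
  left_right : ∀ x, α.eval Y x = 0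
  right_left : ∀ x, β.eval X x = 0
  contr_left_left : ContractionVanishes X α.extD
  contr_right_left : ContractionVanishes Y α.extD
  contr_left_right : ContractionVanishes X β.extD
  contr_right_right : ContractionVanishes Y β.extD

/-- The conditions `α₀(X) = α₀(Y) = β₀(X) = β₀(Y) = 0`. -/
def Compatible (α₀ β₀ : Form d M 1) (X Y : VField d M) : Prop :=
  ∀ x, α₀.eval X x = 0 ∧ α₀.eval Y x = 0 ∧ β₀.eval X x = 0 ∧ β₀.eval Y x = 0

variable (d M) in
/-- `M` admits an orientation, that is, a volume form. -/
def IsOrientable : Prop :=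
  ∃ Ω : Form d M d, Ω.IsSmooth ∧ ∀ x, Ω x ≠ 0

end Manifold

end

end ContactPairs

namespace ContactPairs

/-! ### Wedge products, and vectors annihilating forms -/

section LinearAlgebra

variable {V : Type*} [AddCommGroup V] [Module ℝ V] {p q : ℕ}

/-! Since `α₀` and `β₀` are closed, passing to `α₀ + t α`, `β₀ + t β` multiplies the exterior
derivatives by `t`, so the power conditions only rescale. Expanding the volume condition bilinearly
gives four terms. Each of the three containing `α₀` or `β₀` is annihilated by one of the Reeb
vectors, and a top-degree form annihilated by a nonzero vector is zero (`IsAnnihilated.eq_zero`).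
What remains is `t ^ (k + l + 2)` times the original form (`wedge_add_smul_eq_smul`).

Hence, given Reeb fields in the kernels of `α₀` and `β₀`, the contact pair condition is the same
before and after the perturbation (`isContactPair_add_smul_iff`). For the converse, the Reeb
relations are affine in `t`, so two values of `t` recover both those of `(α, β)` and the kernel
conditions (`reebPair_of_forall_add_smul`). -/

theorem wedge_add_left (a a' : V [⋀^Fin p]→ₗ[ℝ] ℝ) (b : V [⋀^Fin q]→ₗ[ℝ] ℝ) :
    wedge (a + a') b = wedge a b + wedge a' b := by
  unfold wedge
  rw [← AlternatingMap.domCoprod'_apply, TensorProduct.add_tmul, map_add]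
  ext v
  simp

theorem wedge_add_right (a : V [⋀^Fin p]→ₗ[ℝ] ℝ) (b b' : V [⋀^Fin q]→ₗ[ℝ] ℝ) :
    wedge a (b + b') = wedge a b + wedge a b' := by
  unfold wedge
  rw [← AlternatingMap.domCoprod'_apply, TensorProduct.tmul_add, map_add]
  ext v
  simp

theorem wedge_smul_left (c : ℝ) (a : V [⋀^Fin p]→ₗ[ℝ] ℝ) (b : V [⋀^Fin q]→ₗ[ℝ] ℝ) :
    wedge (c • a) b = c • wedge a b := by
  unfold wedge
  rw [← AlternatingMap.domCoprod'_apply, ← TensorProduct.smul_tmul', map_smul]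
  ext v
  simp

theorem wedge_smul_right (c : ℝ) (a : V [⋀^Fin p]→ₗ[ℝ] ℝ) (b : V [⋀^Fin q]→ₗ[ℝ] ℝ) :
    wedge a (c • b) = c • wedge a b := by
  unfold wedge
  rw [← AlternatingMap.domCoprod'_apply, TensorProduct.tmul_smul, map_smul]
  ext v
  simp

theorem wedgePow_smul (c : ℝ) (b : V [⋀^Fin 2]→ₗ[ℝ] ℝ) (k : ℕ) :
    wedgePow (c • b) k = c ^ k • wedgePow b k := by
  induction k with
  | zero => simp [wedgePow]
  | succ k ih =>
    simp only [wedgePow]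
    rw [ih, wedge_smul_left, wedge_smul_right, smul_smul, pow_succ]

/-- The form `a` vanishes as soon as one of its arguments is `e`, that is, `i_e a = 0`. -/
def IsAnnihilated (e : V) (a : V [⋀^Fin p]→ₗ[ℝ] ℝ) : Prop :=
  ∀ (v : Fin p → V) (i : Fin p), v i = e → a v = 0

/-- In each shuffle summand the argument `e` is fed either to `a` or to `b`, so one factor vanishes.
-/
theorem IsAnnihilated.wedge {e : V} {a : V [⋀^Fin p]→ₗ[ℝ] ℝ} {b : V [⋀^Fin q]→ₗ[ℝ] ℝ}
    (ha : IsAnnihilated e a) (hb : IsAnnihilated e b) :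
    IsAnnihilated e (ContactPairs.wedge a b) := by
  intro v i hi
  simp only [ContactPairs.wedge, AlternatingMap.domDomCongr_apply,
    LinearMap.compAlternatingMap_apply, AlternatingMap.domCoprod_apply, sum_apply, map_sum]
  refine Finset.sum_eq_zero fun σ _ => ?_
  induction σ using Quotient.inductionOn' with | _ σ
  rw [AlternatingMap.domCoprod.summand_mk'']
  simp only [smul_apply, MultilinearMap.domDomCongr_apply,
    MultilinearMap.domCoprod_apply, AlternatingMap.coe_multilinearMap]
  rcases hj : σ⁻¹ (finSumFinEquiv.symm i) with j | j <;> rw [Equiv.Perm.inv_eq_iff_eq] at hj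
  · rw [ha _ j (by simp [← hj, hi])]
    simp
  · rw [hb _ j (by simp [← hj, hi])]
    simp

theorem IsAnnihilated.wedgePow {e : V} {b : V [⋀^Fin 2]→ₗ[ℝ] ℝ} (hb : IsAnnihilated e b) (k : ℕ) :
    IsAnnihilated e (ContactPairs.wedgePow b k) := by
  induction k with
  | zero => exact fun _ i => i.elim0
  | succ k ih => exact ih.wedge hb

theorem isAnnihilated_one {e : V} {a : V [⋀^Fin 1]→ₗ[ℝ] ℝ} (h : a ![e] = 0) :
    IsAnnihilated e a := by
  intro v i hi
  rw [← h]
  congr 1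
  ext j
  rw [Subsingleton.elim j i, hi]
  simp [Subsingleton.elim i 0]

theorem isAnnihilated_two {e : V} {b : V [⋀^Fin 2]→ₗ[ℝ] ℝ} (h : ∀ v, b ![e, v] = 0) :
    IsAnnihilated e b := by
  intro v i hi
  have key : ∀ w : Fin 2 → V, w 0 = e → b w = 0 := by
    intro w hw
    rw [← h (w 1), ← hw]
    congr 1
    ext j
    fin_cases j <;> rfl
  fin_cases i
  · exact key v hi
  · have := b.map_swap v (i := 0) (j := 1) (by decide)
    rw [key _ (by simpa using hi)] at this
    linarith

/-- A form of top degree annihilated by a nonzero vector vanishes. -/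
theorem IsAnnihilated.eq_zero {e : V} {a : V [⋀^Fin p]→ₗ[ℝ] ℝ} (ha : IsAnnihilated e a)
    (he : e ≠ 0) [FiniteDimensional ℝ V] (hp : Module.finrank ℝ V = p) : a = 0 := by
  have hli : LinearIndepOn ℝ id ({e} : Set V) := LinearIndepOn.singleton he
  let B := Module.Basis.extend hli
  have : Fintype (hli.extend (Set.subset_univ {e})) := FiniteDimensional.fintypeBasisIndex B
  -- On a basis containing `e`, only injective families matter; by cardinality such a family is
  -- onto, so `e` occurs in it.
  refine B.ext_alternating fun v hv => ?_
  have hcard : Fintype.card (Fin p) = Fintype.card (hli.extend (Set.subset_univ {e})) := by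
    rw [← Module.finrank_eq_card_basis B, hp, Fintype.card_fin]
  obtain ⟨i, hi⟩ := ((Fintype.bijective_iff_injective_and_card v).2 ⟨hv, hcard⟩).2
    ⟨e, hli.subset_extend _ rfl⟩
  exact ha _ i (by simp [hi, B])

/-- Adding to `t a` and `t b` covectors that kill the vectors dual to `a` and `b` rescales
`a ∧ A ^ k ∧ b ∧ B ^ l` in top degree. -/
theorem wedge_add_smul_eq_smul [FiniteDimensional ℝ V] {k l : ℕ}
    (hd : Module.finrank ℝ V = 1 + 2 * k + 1 + 2 * l) {e f : V} (he : e ≠ 0) (hf : f ≠ 0)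
    {a₀ a b₀ b : V [⋀^Fin 1]→ₗ[ℝ] ℝ} {A B : V [⋀^Fin 2]→ₗ[ℝ] ℝ}
    (ha₀e : IsAnnihilated e a₀) (hb₀e : IsAnnihilated e b₀) (hb₀f : IsAnnihilated f b₀)
    (hbe : IsAnnihilated e b) (haf : IsAnnihilated f a) (hAe : IsAnnihilated e A)
    (hAf : IsAnnihilated f A) (hBe : IsAnnihilated e B) (hBf : IsAnnihilated f B) (t : ℝ) :
    wedge (wedge (wedge (a₀ + t • a) (wedgePow (t • A) k)) (b₀ + t • b)) (wedgePow (t • B) l) =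
      t ^ (k + l + 2) • wedge (wedge (wedge a (wedgePow A k)) b) (wedgePow B l) := by
  -- The vector `e` kills every factor of the two terms with `a₀`; for the term with `a` and `b₀` it
  -- is `f` that does.
  have h₁ : wedge (wedge (wedge a₀ (wedgePow A k)) b₀) (wedgePow B l) = 0 :=
    (((ha₀e.wedge (hAe.wedgePow k)).wedge hb₀e).wedge (hBe.wedgePow l)).eq_zero he hd
  have h₂ : wedge (wedge (wedge a₀ (wedgePow A k)) b) (wedgePow B l) = 0 :=
    (((ha₀e.wedge (hAe.wedgePow k)).wedge hbe).wedge (hBe.wedgePow l)).eq_zero he hd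
  have h₃ : wedge (wedge (wedge a (wedgePow A k)) b₀) (wedgePow B l) = 0 :=
    (((haf.wedge (hAf.wedgePow k)).wedge hb₀f).wedge (hBf.wedgePow l)).eq_zero hf hd
  simp only [wedgePow_smul, wedge_add_left, wedge_add_right, wedge_smul_left, wedge_smul_right,
    h₁, h₂, h₃, smul_zero, zero_add, add_zero, smul_smul]
  congr 1
  ring

end LinearAlgebra

/-! ### Perturbed forms and vector fields on a manifold -/

section Manifold

variable {d : ℕ} {M : Type*} [TopologicalSpace M] [ChartedSpace (EuclideanSpace ℝ (Fin d)) M]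

theorem Form.inChart_add_smul {p : ℕ} (η θ : Form d M p) (t : ℝ) (x : M) :
    (η + t • θ).inChart x = η.inChart x + t • θ.inChart x := by
  ext y v
  rfl

theorem Form.IsSmooth.add_smul {p : ℕ} {η θ : Form d M p} (hη : η.IsSmooth) (hθ : θ.IsSmooth)
    (t : ℝ) : (η + t • θ).IsSmooth := by
  intro x
  rw [Form.inChart_add_smul]
  exact (hη x).add ((hθ x).const_smul t)

theorem Form.IsSmooth.differentiableAt_inChart {p : ℕ} {η : Form d M p} (hη : η.IsSmooth)
    (x : M) : DifferentiableAt ℝ (η.inChart x) (extChartAt (𝓡 d) x x) :=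
  ((hη x).contDiffAt (extChartAt_target_mem_nhds x)).differentiableAt (by simp)

theorem Form.extD_add_smul {p : ℕ} {η θ : Form d M p} (hη : η.IsSmooth) (hθ : θ.IsSmooth)
    (t : ℝ) : (η + t • θ).extD = η.extD + t • θ.extD := by
  funext x
  unfold Form.extD
  rw [Form.inChart_add_smul, extDeriv_add (hη.differentiableAt_inChart x)
    ((hθ.differentiableAt_inChart x).const_smul t), extDeriv_smul]
  ext v
  rfl

theorem Form.extD_add_smul_of_closed {p : ℕ} {η θ : Form d M p} (hη : η.IsSmooth)
    (hθ : θ.IsSmooth) (hclosed : η.extD = 0) (t : ℝ) : (η + t • θ).extD = t • θ.extD := by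
  rw [Form.extD_add_smul hη hθ, hclosed, zero_add]

theorem VField.IsSmooth.const_smul [IsManifold (𝓡 d) ∞ M] {X : VField d M} (hX : X.IsSmooth)
    (c : ℝ) : VField.IsSmooth (c • X) :=
  ContMDiff.const_smul_section hX

theorem vecCons_update_zero {V : Type*} {n : ℕ} (e e' : V) (v : Fin n → V) :
    Function.update (Matrix.vecCons e v) 0 e' = Matrix.vecCons e' v :=
  Fin.update_cons_zero (α := fun _ => V) e v e'

theorem Form.eval_smul (α : Form d M 1) (c : ℝ) (X : VField d M) (x : M) :
    α.eval (c • X) x = c * α.eval X x := by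
  have h := (α x).map_update_smul ![X x] 0 c (X x)
  rwa [vecCons_update_zero, vecCons_update_zero] at h

theorem Form.eval_add_smul (α₀ α : Form d M 1) (t : ℝ) (X : VField d M) (x : M) :
    (α₀ + t • α).eval X x = α₀.eval X x + t * α.eval X x :=
  rfl

/-- The hypothesis reads `α₀(X) + t α(X) = t c`; the values at `t = 1` and `t = 2` determine both
unknowns. -/
theorem Form.eval_of_forall_add_smul {α₀ α : Form d M 1} {X : VField d M} {x : M} {c : ℝ}
    (h : ∀ t : ℝ, 0 < t → (α₀ + t • α).eval (t⁻¹ • X) x = c) :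
    α₀.eval X x = 0 ∧ α.eval X x = c := by
  have h₁ := h 1 one_pos
  have h₂ := h 2 two_pos
  rw [Form.eval_smul, Form.eval_add_smul] at h₁ h₂
  constructor <;> linarith

theorem ContractionVanishes.smul_smul {X : VField d M} {η : Form d M 2}
    (h : ContractionVanishes X η) (c t : ℝ) : ContractionVanishes (c • X) (t • η) := by
  intro x v
  have h' := (η x).map_update_smul ![X x, v] 0 c (X x)
  rw [vecCons_update_zero, vecCons_update_zero, h x v, smul_zero] at h'
  exact (congrArg (t • ·) h').trans (smul_zero t)

theorem Form.isAnnihilated_of_eval {α : Form d M 1} {X : VField d M} {x : M}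
    (h : α.eval X x = 0) : IsAnnihilated (X x) (α x).toAlternatingMap :=
  isAnnihilated_one h

theorem ContractionVanishes.isAnnihilated {X : VField d M} {η : Form d M 2}
    (h : ContractionVanishes X η) (x : M) : IsAnnihilated (X x) (η x).toAlternatingMap :=
  isAnnihilated_two (h x)

/-- Supplies the nonvanishing required to kill top-degree forms. -/
theorem VField.ne_zero_of_eval {α : Form d M 1} {X : VField d M} {x : M}
    (h : α.eval X x = 1) : X x ≠ 0 := by
  intro hX
  have h' : α x ![X x] = 0 := (α x).map_coord_zero 0 (by simpa using hX)
  exact zero_ne_one (h'.symm.trans h)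

theorem wedgePow_extD_add_smul {η θ : Form d M 1} (hη : η.IsSmooth) (hθ : θ.IsSmooth)
    (hclosed : η.extD = 0) (t : ℝ) (k : ℕ) (x : M) :
    wedgePow ((η + t • θ).extD x).toAlternatingMap k =
      t ^ k • wedgePow (θ.extD x).toAlternatingMap k := by
  rw [Form.extD_add_smul_of_closed hη hθ hclosed]
  exact wedgePow_smul t (θ.extD x).toAlternatingMap k

/-! ### Contact pairs and Reeb fields under perturbation -/

variable [IsManifold (𝓡 d) ∞ M] {α₀ β₀ α β : Form d M 1}

theorem contactForm_add_smul {k l : ℕ} (hα₀ : α₀.IsSmooth) (hβ₀ : β₀.IsSmooth)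
    (hα₀_closed : α₀.extD = 0) (hβ₀_closed : β₀.extD = 0) (hα : α.IsSmooth) (hβ : β.IsSmooth)
    (hd : d = 2 * k + 2 * l + 2) {E F : VField d M} (hR : IsReebPair α β E F)
    (hC : Compatible α₀ β₀ E F) (t : ℝ) (x : M) :
    contactForm k l (α₀ + t • α) (β₀ + t • β) x = t ^ (k + l + 2) • contactForm k l α β x := by
  unfold contactForm
  rw [Form.extD_add_smul_of_closed hα₀ hα hα₀_closed, Form.extD_add_smul_of_closed hβ₀ hβ hβ₀_closed]
  obtain ⟨h₁, h₂, h₃, h₄⟩ := hC x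
  have : FiniteDimensional ℝ (TangentSpace (𝓡 d) x) :=
    inferInstanceAs (FiniteDimensional ℝ (EuclideanSpace ℝ (Fin d)))
  have hfin : Module.finrank ℝ (TangentSpace (𝓡 d) x) = 1 + 2 * k + 1 + 2 * l := by
    change Module.finrank ℝ (EuclideanSpace ℝ (Fin d)) = _
    rw [finrank_euclideanSpace_fin]
    omega
  exact wedge_add_smul_eq_smul hfin (VField.ne_zero_of_eval (hR.left_left x))
    (VField.ne_zero_of_eval (hR.right_right x)) (Form.isAnnihilated_of_eval h₁)
    (Form.isAnnihilated_of_eval h₃) (Form.isAnnihilated_of_eval h₄)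
    (Form.isAnnihilated_of_eval (hR.right_left x)) (Form.isAnnihilated_of_eval (hR.left_right x))
    (hR.contr_left_left.isAnnihilated x) (hR.contr_right_left.isAnnihilated x)
    (hR.contr_left_right.isAnnihilated x) (hR.contr_right_right.isAnnihilated x) t

/-- The contact pair condition for `(α₀ + t α, β₀ + t β)` is that for `(α, β)`, provided the Reeb
fields of `(α, β)` lie in the kernels of `α₀` and `β₀`. -/
theorem isContactPair_add_smul_iff {k l : ℕ} (hα₀ : α₀.IsSmooth) (hβ₀ : β₀.IsSmooth)
    (hα₀_closed : α₀.extD = 0) (hβ₀_closed : β₀.extD = 0) (hα : α.IsSmooth) (hβ : β.IsSmooth)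
    {E F : VField d M} (hR : IsReebPair α β E F) (hC : Compatible α₀ β₀ E F) {t : ℝ}
    (ht : t ≠ 0) :
    IsContactPair k l (α₀ + t • α) (β₀ + t • β) ↔ IsContactPair k l α β := by
  constructor
  · intro h
    refine ⟨hα, hβ, h.top_degree, fun x hx => h.volume x ?_, fun x => ?_, fun x => ?_⟩
    · rw [contactForm_add_smul hα₀ hβ₀ hα₀_closed hβ₀_closed hα hβ h.top_degree hR hC, hx,
        smul_zero]
    · have := h.pow_left x
      rw [wedgePow_extD_add_smul hα₀ hα hα₀_closed] at this
      exact (smul_eq_zero.1 this).resolve_left (pow_ne_zero _ ht)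
    · have := h.pow_right x
      rw [wedgePow_extD_add_smul hβ₀ hβ hβ₀_closed] at this
      exact (smul_eq_zero.1 this).resolve_left (pow_ne_zero _ ht)
  · intro h
    refine ⟨hα₀.add_smul hα t, hβ₀.add_smul hβ t, h.top_degree, fun x => ?_, fun x => ?_,
      fun x => ?_⟩
    · rw [contactForm_add_smul hα₀ hβ₀ hα₀_closed hβ₀_closed hα hβ h.top_degree hR hC]
      exact smul_ne_zero (pow_ne_zero _ ht) (h.volume x)
    · rw [wedgePow_extD_add_smul hα₀ hα hα₀_closed, h.pow_left, smul_zero]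
    · rw [wedgePow_extD_add_smul hβ₀ hβ hβ₀_closed, h.pow_right, smul_zero]

theorem IsReebPair.add_smul (hα₀ : α₀.IsSmooth) (hβ₀ : β₀.IsSmooth)
    (hα₀_closed : α₀.extD = 0) (hβ₀_closed : β₀.extD = 0) (hα : α.IsSmooth) (hβ : β.IsSmooth)
    {E F : VField d M} (hR : IsReebPair α β E F) (hC : Compatible α₀ β₀ E F) {t : ℝ}
    (ht : t ≠ 0) :
    IsReebPair (α₀ + t • α) (β₀ + t • β) (t⁻¹ • E) (t⁻¹ • F) where
  smooth_left := hR.smooth_left.const_smul _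
  smooth_right := hR.smooth_right.const_smul _
  left_left x := by
    rw [Form.eval_smul, Form.eval_add_smul, (hC x).1, hR.left_left, zero_add, mul_one,
      inv_mul_cancel₀ ht]
  right_right x := by
    rw [Form.eval_smul, Form.eval_add_smul, (hC x).2.2.2, hR.right_right, zero_add, mul_one,
      inv_mul_cancel₀ ht]
  left_right x := by
    rw [Form.eval_smul, Form.eval_add_smul, (hC x).2.1, hR.left_right, mul_zero, add_zero,
      mul_zero]
  right_left x := by
    rw [Form.eval_smul, Form.eval_add_smul, (hC x).2.2.1, hR.right_left, mul_zero, add_zero,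
      mul_zero]
  contr_left_left := by
    rw [Form.extD_add_smul_of_closed hα₀ hα hα₀_closed]
    exact hR.contr_left_left.smul_smul _ _
  contr_right_left := by
    rw [Form.extD_add_smul_of_closed hα₀ hα hα₀_closed]
    exact hR.contr_right_left.smul_smul _ _
  contr_left_right := by
    rw [Form.extD_add_smul_of_closed hβ₀ hβ hβ₀_closed]
    exact hR.contr_left_right.smul_smul _ _
  contr_right_right := by
    rw [Form.extD_add_smul_of_closed hβ₀ hβ hβ₀_closed]
    exact hR.contr_right_right.smul_smul _ _

theorem reebPair_of_forall_add_smul (hα₀ : α₀.IsSmooth) (hβ₀ : β₀.IsSmooth)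
    (hα₀_closed : α₀.extD = 0) (hβ₀_closed : β₀.extD = 0) (hα : α.IsSmooth) (hβ : β.IsSmooth)
    {X Y : VField d M}
    (h : ∀ t : ℝ, 0 < t → IsReebPair (α₀ + t • α) (β₀ + t • β) (t⁻¹ • X) (t⁻¹ • Y)) :
    IsReebPair α β X Y ∧ Compatible α₀ β₀ X Y := by
  have h₁ := h 1 one_pos
  have hXα x := Form.eval_of_forall_add_smul fun t ht => (h t ht).left_left x
  have hYα x := Form.eval_of_forall_add_smul fun t ht => (h t ht).left_right x
  have hXβ x := Form.eval_of_forall_add_smul fun t ht => (h t ht).right_left x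
  have hYβ x := Form.eval_of_forall_add_smul fun t ht => (h t ht).right_right x
  have hdα : (α₀ + (1 : ℝ) • α).extD = α.extD := by
    rw [Form.extD_add_smul_of_closed hα₀ hα hα₀_closed, one_smul]
  have hdβ : (β₀ + (1 : ℝ) • β).extD = β.extD := by
    rw [Form.extD_add_smul_of_closed hβ₀ hβ hβ₀_closed, one_smul]
  -- Smoothness and the contraction conditions need only `t = 1`, where the fields are `X`, `Y`
  -- themselves and the exterior derivatives are those of `α`, `β`.
  obtain ⟨hX, hY, -, -, -, -, c₁, c₂, c₃, c₄⟩ := h₁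
  rw [hdα, inv_one, one_smul] at c₁ c₂
  rw [hdβ, inv_one, one_smul] at c₃ c₄
  rw [inv_one, one_smul] at hX hY
  exact ⟨⟨hX, hY, fun x => (hXα x).2, fun x => (hYβ x).2, fun x => (hYα x).2,
    fun x => (hXβ x).2, c₁, c₂, c₃, c₄⟩,
    fun x => ⟨(hXα x).1, (hYα x).1, (hXβ x).1, (hYβ x).1⟩⟩

end Manifold

end ContactPairs

open ContactPairs in
theorem mainTheorem1 (n : ℕ) (M : Type*) [TopologicalSpace M] [T2Space M]
    [SecondCountableTopology M] [ChartedSpace (EuclideanSpace ℝ (Fin (2 * n))) M]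
    [IsManifold (𝓡 (2 * n)) ∞ M]
    (α₀ β₀ : Form (2 * n) M 1) (hα₀ : α₀.IsSmooth) (hβ₀ : β₀.IsSmooth)
    (hα₀_closed : α₀.extD = 0) (hβ₀_closed : β₀.extD = 0)
    (hindep : ∀ x, LinearIndependent ℝ ![α₀ x, β₀ x])
    (α β : Form (2 * n) M 1) (hα : α.IsSmooth) (hβ : β.IsSmooth) (k l : ℕ) :
    -- the sufficient condition, on every even-dimensional manifold
    (∀ E F : VField (2 * n) M,
      IsContactPair k l α β → IsReebPair α β E F → Compatible α₀ β₀ E F →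
      ∀ t : ℝ, 0 < t →
        IsContactPair k l (α₀ + t • α) (β₀ + t • β) ∧
        IsReebPair (α₀ + t • α) (β₀ + t • β) (t⁻¹ • E) (t⁻¹ • F)) ∧
    (CompactSpace M → IsOrientable (2 * n) M →
      -- the necessary condition
      (∀ X Y : VField (2 * n) M,
        (∀ t : ℝ, 0 < t →
          IsContactPair k l (α₀ + t • α) (β₀ + t • β) ∧
          IsReebPair (α₀ + t • α) (β₀ + t • β) (t⁻¹ • X) (t⁻¹ • Y)) →
        IsContactPair k l α β ∧ IsReebPair α β X Y ∧ Compatible α₀ β₀ X Y) ∧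
      -- the equivalence
      ((∃ X Y : VField (2 * n) M, ∀ t : ℝ, 0 < t →
          IsContactPair k l (α₀ + t • α) (β₀ + t • β) ∧
          IsReebPair (α₀ + t • α) (β₀ + t • β) (t⁻¹ • X) (t⁻¹ • Y)) ↔
        (IsContactPair k l α β ∧
          ∃ E F : VField (2 * n) M, IsReebPair α β E F ∧ Compatible α₀ β₀ E F))) := by
  have sufficient : ∀ E F : VField (2 * n) M,
      IsContactPair k l α β → IsReebPair α β E F → Compatible α₀ β₀ E F →
      ∀ t : ℝ, 0 < t →
        IsContactPair k l (α₀ + t • α) (β₀ + t • β) ∧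
        IsReebPair (α₀ + t • α) (β₀ + t • β) (t⁻¹ • E) (t⁻¹ • F) :=
    fun E F hP hR hC t ht =>
      ⟨(isContactPair_add_smul_iff hα₀ hβ₀ hα₀_closed hβ₀_closed hα hβ hR hC ht.ne').2 hP,
        hR.add_smul hα₀ hβ₀ hα₀_closed hβ₀_closed hα hβ hC ht.ne'⟩
  have necessary : ∀ X Y : VField (2 * n) M,
      (∀ t : ℝ, 0 < t →
        IsContactPair k l (α₀ + t • α) (β₀ + t • β) ∧
        IsReebPair (α₀ + t • α) (β₀ + t • β) (t⁻¹ • X) (t⁻¹ • Y)) →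
      IsContactPair k l α β ∧ IsReebPair α β X Y ∧ Compatible α₀ β₀ X Y := by
    intro X Y h
    -- The Reeb relations come first: they make the volume identity available, and it then transfers
    -- the contact condition from `t = 1`.
    obtain ⟨hR, hC⟩ := reebPair_of_forall_add_smul hα₀ hβ₀ hα₀_closed hβ₀_closed hα hβ
      fun t ht => (h t ht).2
    exact ⟨(isContactPair_add_smul_iff hα₀ hβ₀ hα₀_closed hβ₀_closed hα hβ hR hC
      one_ne_zero).1 (h 1 one_pos).1, hR, hC⟩
  refine ⟨sufficient, fun _ _ => ⟨necessary, ?_, ?_⟩⟩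
  · rintro ⟨X, Y, h⟩
    exact ⟨(necessary X Y h).1, X, Y, (necessary X Y h).2⟩
  · rintro ⟨hP, E, F, hR, hC⟩
    exact ⟨E, F, sufficient E F hP hR hC⟩
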